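/- Let $T_0>0$, $\sigma_c>0$, $K\ge 0$, let $\Theta\subseteq\mathbb R^K$ be open, and for $\theta\in\Theta$ let $h_\theta\in L_2[0,T_0]$ be a real-valued signal ($L_2[0,T_0]$ is the Hilbert space of complex-valued square-integrable functions). Assume that $\theta\mapsto h_\theta$ is Fréchet differentiable at every $\theta\in\Theta$ and that each derivative $\partial h_\theta/\partial\theta:\mathbb R^K\to L_2[0,T_0]$ has trivial null space. The signal $x=h_\theta$ is observed as $y(t)=x(t)+w(t)$, $t\in[0,T_0]$, where $w$ is continuous-time white Gaussian noise of level $\sigma_c^2$; formally, under the probability measure $P_\theta$ the measured process is $$z(t)=\int_0^t h_\theta(\tau)\,d\tau+\sigma_c\,b(t),\qquad t\in[0,T_0],$$ with $b$ a standard (real) Wiener process. Let $\hat x$ be an estimator, that is, a measurable $L_2[0,T_0]$-valued function of the path $z$, which is unbiased: $\mathbb E_\theta[\hat x]=h_\theta$ for all $\theta\in\Theta$ (the expectation of a random element $v$ of $L_2$ is the $k\in L_2$ with $\langle k,\varphi\rangle=\mathbb E\langle v,\varphi\rangle$ for all $\varphi\in L_2$). Then for every $\theta\in\Theta$ with $\mathbb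 E_\theta\|\hat x\|^2<\infty$, writing $x=h_\theta$, $$\mathrm{MSE}(\hat x,x)=\mathbb E_\theta\|\hat x-x\|_{L_2}^2\ \ge\ K\sigma_c^2 .$$ Moreover, let $X$ be a set of locally square-integrable signals on $\mathbb R$, and let $N_{T_0}(t)\in\{0,1,2,\dots,\infty\}$ be the number of parameters defining their segments over $[t-T_0/2,t+T_0/2]$, i.e. the least $n$ such that the set of these segments is the image of an open subset of $\mathbb R^n$ under a Fréchet-differentiable map into $L_2$ (infinite if there is none). Let $\rho_{T_0}=\sup_{t\in\mathbb R}N_{T_0}(t)/T_0$ be the $T_0$-local rate of innovation. If $\{h_\theta:\theta\in\Theta\}$ is the set of segments of $X$ over $[0,T_0]$ and this window has the largest number of degrees of freedom, $N_{T_0}(t)\le N_{T_0}(T_0/2)$ for all $t$, then for the same $\hat x$ and $x$ $$\frac{\frac1{T_0}\,\mathrm{MSE}(\hat x,x)}{\sigma_c^2}\ \ge\ \rho_{T_0}.$$ -/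

import Mathlib

open MeasureTheory ProbabilityTheory Set
open scoped ENNReal

noncomputable section

namespace FRI

/-- Lebesgue measure on `[0, T]`. -/
abbrev window (T : ℝ) : Measure ℝ := volume.restrict (Icc 0 T)

/-- The Hilbert space `L₂[0, T]` of complex-valued square-integrable functions. -/
abbrev L2 (T : ℝ) : Type := Lp ℂ 2 (window T)

/-- The space `ℝⁿ` of parameter vectors, with its Euclidean norm. -/
abbrev Param (n : ℕ) : Type := EuclideanSpace ℝ (Fin n)

/-- A standard (real) Wiener process on the time interval `[0, T]`: a centred Gaussian process
with covariance `min s t` and almost surely continuous paths. -/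
structure IsWienerProcess {Ω : Type*} [MeasurableSpace Ω] {T : ℝ}
    (b : Icc (0 : ℝ) T → Ω → ℝ) (P : Measure Ω) : Prop where
  gaussian : IsGaussianProcess b P
  mean_eq_zero : ∀ t, ∫ ω, b t ω ∂P = 0
  covariance_eq : ∀ s t, cov[b s, b t; P] = min (s : ℝ) (t : ℝ)
  continuous_paths : ∀ᵐ ω ∂P, Continuous fun t => b t ω

/-- Under `P`, the process `z` is the observation of the signal `x` in continuous-time white
Gaussian noise of level `σ`, i.e. `z t = ∫₀ᵗ x(τ) dτ + σ b(t)` on `[0, T]` for some standard Wiener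
process `b`. -/
def IsNoisyObservation {Ω : Type*} [MeasurableSpace Ω] {T : ℝ} (σ : ℝ) (x : L2 T)
    (z : Icc (0 : ℝ) T → Ω → ℂ) (P : Measure Ω) : Prop :=
  ∃ b : Icc (0 : ℝ) T → Ω → ℝ, IsWienerProcess b P ∧
    ∀ᵐ ω ∂P, ∀ t : Icc (0 : ℝ) T,
      z t ω = (∫ τ in (0 : ℝ)..t, x τ) + (σ : ℂ) * (b t ω : ℂ)

/-- An estimator of an `L₂[0, T]` signal from the whole observed path. The space of paths carries
the product σ-algebra, generated by the evaluations at the times `t ∈ [0, T]`. -/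
abbrev Estimator (T : ℝ) : Type := (Icc (0 : ℝ) T → ℂ) → L2 T

/-- The expectation under `P` of the random element `v` of `L₂[0, T]` exists and equals `m`:
`E⟨φ, v⟩` exists and equals `⟨φ, m⟩` for every `φ ∈ L₂[0, T]`. -/
def HasMean {Ω : Type*} [MeasurableSpace Ω] {T : ℝ} (v : Ω → L2 T) (m : L2 T)
    (P : Measure Ω) : Prop :=
  ∀ φ : L2 T, Integrable (fun ω => inner ℂ φ (v ω)) P ∧
    ∫ ω, inner ℂ φ (v ω) ∂P = inner ℂ φ m

/-- The estimator `xhat`, applied to the observation `z`, is unbiased over the signals `h θ`,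
`θ ∈ Θ`, where `P θ` is the probability measure in force when the parameter is `θ`. -/
def IsUnbiased {Ω : Type*} [MeasurableSpace Ω] {K : ℕ} {T : ℝ} (Θ : Set (Param K))
    (h : Param K → L2 T) (P : Param K → Measure Ω) (z : Icc (0 : ℝ) T → Ω → ℂ)
    (xhat : Estimator T) : Prop :=
  ∀ θ ∈ Θ, HasMean (fun ω => xhat fun t => z t ω) (h θ) (P θ)

/-- The mean-square error `E‖xhat - x‖²` of the estimator `xhat` at the signal `x`. -/
def mse {Ω : Type*} [MeasurableSpace Ω] {T : ℝ} (P : Measure Ω) (z : Icc (0 : ℝ) T → Ω → ℂ)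
    (xhat : Estimator T) (x : L2 T) : ℝ≥0∞ :=
  ∫⁻ ω, ‖xhat (fun t => z t ω) - x‖ₑ ^ 2 ∂P

/-- The segments over the window `[t - T/2, t + T/2]` of the signals in `X`, each translated to
`[0, T]`. -/
def segments (T : ℝ) (X : Set (ℝ → ℂ)) (t : ℝ) : Set (L2 T) :=
  {f | ∃ x ∈ X, f =ᵐ[window T] fun s => x (t - T / 2 + s)}

/-- The `T`-local number of degrees of freedom at time `t` of the signals in `X`: the least number
`n` of real parameters in a Fréchet-differentiable parametrization, by an open subset of `ℝⁿ`, of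
their segments over `[t - T/2, t + T/2]` (infinite if there is no such parametrization). -/
def localDegreesOfFreedom (T : ℝ) (X : Set (ℝ → ℂ)) (t : ℝ) : ℕ∞ :=
  ⨅ (n : ℕ) (_ : ∃ (Θ : Set (Param n)) (h : Param n → L2 T),
    IsOpen Θ ∧ (∀ θ ∈ Θ, DifferentiableAt ℝ h θ) ∧ h '' Θ = segments T X t), (n : ℕ∞)

/-- The `T`-local rate of innovation of the signals in `X`. -/
def rateOfInnovation (T : ℝ) (X : Set (ℝ → ℂ)) : ℝ≥0∞ :=
  ⨆ t : ℝ, (localDegreesOfFreedom T X t : ℝ≥0∞) / ENNReal.ofReal T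

end FRI

end

noncomputable section

namespace FRI

/-! ### Centred Gaussian elements of `L²(P)` and the density of their exponential tilt. -/

section GaussianHilbert

variable {Ω : Type*} [MeasurableSpace Ω] {P : Measure Ω}

/-! This is the Cramér–Rao inequality, proved one tangent direction at a time, with the score
realised as a Wiener integral. Signal and noise are real, so passing to the real part of the
estimator on real paths keeps it unbiased and does not increase its error (`cramerRao`).

Fix θ. The Wiener integral W : L₂[0,T] → L²(P_θ) (`exists_paleyWiener`) is a contraction with
centred Gaussian values. By Cameron–Martin (`map_tilted_observation`), tilting P_θ by V = W(σ⁻¹(h_φ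
− h_θ)) gives the path z its law under P_φ. The density exp(V − ‖V‖²/2) equals 1 + V up to an L²
error at most ‖V‖² when ‖V‖ ≤ 1 (`abs_integral_mul_tiltDensity_sub_le`). Comparing the unbiasedness
identities at φ and θ to first order gives E_θ[⟨f, x̂⟩ W(dh v)] = σ⟨f, dh v⟩
(`inner_paleyWiener_fderiv`).

Take f = dh v = u a unit vector. Since W u has mean 0 and norm at most 1, Cauchy–Schwarz gives
E_θ⟨u, x̂ − x⟩² ≥ σ². The range of dh has dimension K, so summing over an orthonormal basis of it
and applying Bessel's inequality gives Kσ² (`cramerRao_real`).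

For the rate of innovation, the model itself parametrizes the central window by K numbers, so by
maximality every window has at most K degrees of freedom. -/

lemma integral_abs_le_norm_Lp [IsProbabilityMeasure P] (V : Lp ℝ 2 P) : ∫ ω, |V ω| ∂P ≤ ‖V‖ := by
  have h1 : eLpNorm V 1 P ≤ eLpNorm V 2 P :=
    eLpNorm_le_eLpNorm_of_exponent_le (by norm_num) (Lp.aestronglyMeasurable V)
  have h2 : ∫ ω, |V ω| ∂P = (eLpNorm V 1 P).toReal := by
    rw [eLpNorm_one_eq_lintegral_enorm, ← integral_norm_eq_lintegral_enorm
      (Lp.aestronglyMeasurable V)]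
    rfl
  rw [h2, Lp.norm_def]
  exact ENNReal.toReal_mono (Lp.eLpNorm_ne_top V) h1

/-- `V` has the centred Gaussian law of variance `‖V‖²`. -/
def IsCentredGaussian (V : Lp ℝ 2 P) : Prop :=
  P.map V = gaussianReal 0 (‖V‖₊ ^ 2)

lemma aemeasurable_Lp (V : Lp ℝ 2 P) : AEMeasurable V P :=
  (Lp.aestronglyMeasurable V).aemeasurable

lemma isCentredGaussian_iff [IsProbabilityMeasure P] (V : Lp ℝ 2 P) :
    IsCentredGaussian V ↔ ∀ t : ℝ, ∫ ω, Complex.exp (t * V ω * Complex.I) ∂P =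
      Complex.exp (-((‖V‖ : ℂ) ^ 2 * t ^ 2 / 2)) := by
  have hc (t : ℝ) : charFun (P.map V) t = ∫ ω, Complex.exp (t * V ω * Complex.I) ∂P := by
    rw [charFun_apply_real, integral_map (aemeasurable_Lp V)]
    exact Continuous.aestronglyMeasurable (by fun_prop)
  have : IsProbabilityMeasure (P.map V) := Measure.isProbabilityMeasure_map (aemeasurable_Lp V)
  constructor
  · intro h t
    rw [← hc, h, charFun_gaussianReal]
    simp
  · intro h
    refine Measure.ext_of_charFun (funext fun t => ?_)
    rw [hc, h, charFun_gaussianReal]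
    simp

/-- Since |e^{ia} − e^{ib}| ≤ |a − b| and the L¹ norm is at most the L² norm, the map is
|t|-Lipschitz. -/
lemma continuous_integral_cexp [IsProbabilityMeasure P] (t : ℝ) :
    Continuous fun V : Lp ℝ 2 P => ∫ ω, Complex.exp (t * V ω * Complex.I) ∂P := by
  have hint (V : Lp ℝ 2 P) : Integrable (fun ω => Complex.exp (t * V ω * Complex.I)) P := by
    refine Integrable.of_bound (C := 1) ?_ (.of_forall fun ω => ?_)
    · exact (Complex.continuous_exp.comp (by fun_prop : Continuous fun x : ℝ =>
        (t * x * Complex.I : ℂ))).comp_aestronglyMeasurable (Lp.aestronglyMeasurable V)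
    · rw [← Complex.ofReal_mul, Complex.norm_exp_ofReal_mul_I]
  refine (LipschitzWith.of_dist_le_mul (K := ‖t‖₊) fun V W => ?_).continuous
  rw [dist_eq_norm, dist_eq_norm, ← integral_sub (hint V) (hint W)]
  have hsub := Lp.coeFn_sub V W
  calc ‖∫ ω, (Complex.exp (t * V ω * Complex.I) - Complex.exp (t * W ω * Complex.I)) ∂P‖
      ≤ ∫ ω, |t| * |(V - W : Lp ℝ 2 P) ω| ∂P := by
        refine norm_integral_le_of_norm_le
          (((Lp.memLp (V - W)).integrable (by norm_num)).abs.const_mul _) ?_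
        filter_upwards [hsub] with ω hω
        have e : Complex.exp (t * V ω * Complex.I) - Complex.exp (t * W ω * Complex.I) =
            Complex.exp ((t * W ω : ℝ) * Complex.I) *
              (Complex.exp (Complex.I * (t * (V ω - W ω) : ℝ)) - 1) := by
          rw [mul_sub, ← Complex.exp_add, mul_one]
          push_cast
          ring_nf
        rw [e, norm_mul, Complex.norm_exp_ofReal_mul_I, one_mul, hω, ← abs_mul]
        exact Real.norm_exp_I_mul_ofReal_sub_one_le
    _ = |t| * ∫ ω, |(V - W : Lp ℝ 2 P) ω| ∂P := integral_const_mul _ _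
    _ ≤ ‖t‖₊ * ‖V - W‖ := by
        rw [coe_nnnorm, Real.norm_eq_abs]
        exact mul_le_mul_of_nonneg_left (integral_abs_le_norm_Lp _) (abs_nonneg t)

/-- The characteristic function and the norm both pass to L² limits. This carries Gaussianity from
finite combinations of the Wiener process to their closed span. -/
lemma isClosed_isCentredGaussian [IsProbabilityMeasure P] :
    IsClosed {V : Lp ℝ 2 P | IsCentredGaussian V} := by
  simp_rw [isCentredGaussian_iff, ofPred_forall]
  refine isClosed_iInter fun t => isClosed_eq (continuous_integral_cexp t) ?_
  fun_prop

namespace IsCentredGaussian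

variable {V : Lp ℝ 2 P}

lemma mgf_eq (hV : IsCentredGaussian V) (t : ℝ) : mgf V P t = Real.exp (‖V‖ ^ 2 * t ^ 2 / 2) := by
  rw [mgf_gaussianReal hV]
  simp

lemma integral_exp (hV : IsCentredGaussian V) :
    ∫ ω, Real.exp (V ω) ∂P = Real.exp (‖V‖ ^ 2 / 2) := by
  simpa [mgf] using hV.mgf_eq 1

lemma integrableExpSet_eq (hV : IsCentredGaussian V) : integrableExpSet V P = univ := by
  ext t
  simp only [integrableExpSet, mem_ofPred_eq, mem_univ, iff_true]
  have h := integrable_exp_mul_gaussianReal (μ := 0) (v := ‖V‖₊ ^ 2) t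
  rw [← hV] at h
  exact (integrable_map_measure (Continuous.aestronglyMeasurable (by fun_prop))
    (aemeasurable_Lp V)).1 h

lemma integrable_exp_mul (hV : IsCentredGaussian V) (t : ℝ) :
    Integrable (fun ω => Real.exp (t * V ω)) P := by
  have := mem_univ t
  rwa [← hV.integrableExpSet_eq] at this

lemma integrable_exp (hV : IsCentredGaussian V) : Integrable (fun ω => Real.exp (V ω)) P := by
  simpa using hV.integrable_exp_mul 1

lemma integral_eq_zero (hV : IsCentredGaussian V) : ∫ ω, V ω ∂P = 0 := by
  have h := integral_id_gaussianReal (μ := 0) (v := ‖V‖₊ ^ 2)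
  rwa [← hV, integral_map (aemeasurable_Lp V) (Continuous.aestronglyMeasurable (by fun_prop))] at h

lemma integral_mul_exp (hV : IsCentredGaussian V) :
    ∫ ω, V ω * Real.exp (V ω) ∂P = ‖V‖ ^ 2 * Real.exp (‖V‖ ^ 2 / 2) := by
  -- The identity is the derivative at 1 of the moment generating function, computed in two ways.
  have h1 := hasDerivAt_mgf (X := V) (μ := P) (t := 1) (by simp [hV.integrableExpSet_eq])
  have h2 : HasDerivAt (mgf V P) (Real.exp (‖V‖ ^ 2 * 1 ^ 2 / 2) *
      (‖V‖ ^ 2 * ((2 : ℕ) * 1 ^ (2 - 1)) / 2)) 1 := by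
    rw [show mgf V P = fun t => Real.exp (‖V‖ ^ 2 * t ^ 2 / 2) from funext hV.mgf_eq]
    exact (((hasDerivAt_pow 2 (1 : ℝ)).const_mul _).div_const 2).exp
  have := h1.unique h2
  simp only [one_mul] at this
  rw [this]
  push_cast
  ring_nf

lemma memLp_exp (hV : IsCentredGaussian V) : MemLp (fun ω => Real.exp (V ω)) 2 P := by
  refine (memLp_two_iff_integrable_sq ?_).2 ?_
  · exact Real.continuous_exp.comp_aestronglyMeasurable (Lp.aestronglyMeasurable V)
  · refine (hV.integrable_exp_mul 2).congr (.of_forall fun ω => ?_)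
    simp only
    rw [← Real.exp_nat_mul]
    norm_num

end IsCentredGaussian

/-- The density `exp (V - ‖V‖² / 2)` of the measure obtained by the Cameron-Martin shift along
`V`. -/
def tiltDensity (V : Lp ℝ 2 P) (ω : Ω) : ℝ := Real.exp (V ω - ‖V‖ ^ 2 / 2)

namespace IsCentredGaussian

variable {V : Lp ℝ 2 P}

lemma memLp_tiltDensity (hV : IsCentredGaussian V) : MemLp (tiltDensity V) 2 P := by
  refine (hV.memLp_exp.const_mul (Real.exp (-(‖V‖ ^ 2 / 2)))).ae_eq (.of_forall fun ω => ?_)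
  simp only [tiltDensity]
  rw [← Real.exp_add]
  ring_nf

lemma integral_tiltDensity (hV : IsCentredGaussian V) : ∫ ω, tiltDensity V ω ∂P = 1 := by
  simp_rw [tiltDensity, Real.exp_sub, integral_div, hV.integral_exp]
  exact div_self (Real.exp_pos _).ne'

lemma integral_sq_tiltDensity (hV : IsCentredGaussian V) :
    ∫ ω, tiltDensity V ω ^ 2 ∂P = Real.exp (‖V‖ ^ 2) := by
  have h := hV.mgf_eq 2
  rw [mgf] at h
  have e (ω : Ω) : tiltDensity V ω ^ 2 = Real.exp (2 * V ω) * Real.exp (-‖V‖ ^ 2) := by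
    rw [tiltDensity, ← Real.exp_nat_mul, ← Real.exp_add]
    push_cast
    ring_nf
  simp_rw [e]
  rw [integral_mul_const, h, ← Real.exp_add]
  ring_nf

lemma integral_mul_tiltDensity (hV : IsCentredGaussian V) :
    ∫ ω, V ω * tiltDensity V ω ∂P = ‖V‖ ^ 2 := by
  simp_rw [tiltDensity, Real.exp_sub, ← mul_div_assoc, integral_div, hV.integral_mul_exp]
  exact mul_div_cancel_right₀ _ (Real.exp_pos _).ne'

lemma integral_sq_tiltDensity_sub [IsProbabilityMeasure P] (hV : IsCentredGaussian V) :
    ∫ ω, (tiltDensity V ω - 1 - V ω) ^ 2 ∂P = Real.exp (‖V‖ ^ 2) - 1 - ‖V‖ ^ 2 := by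
  have hg := hV.memLp_tiltDensity
  have hv := Lp.memLp V
  have i1 : Integrable (fun ω => tiltDensity V ω ^ 2) P := hg.integrable_sq
  have i2 : Integrable (fun ω => V ω ^ 2) P := hv.integrable_sq
  have i3 : Integrable (fun ω => V ω * tiltDensity V ω) P := hv.integrable_mul hg
  have i4 : Integrable (fun ω => V ω) P := hv.integrable (by norm_num)
  have i5 : Integrable (fun ω => tiltDensity V ω) P := hg.integrable (by norm_num)
  have hV2 : ∫ ω, V ω ^ 2 ∂P = ‖V‖ ^ 2 := by
    rw [← real_inner_self_eq_norm_sq, L2.inner_def]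
    simp [sq]
  have e (ω : Ω) : (tiltDensity V ω - 1 - V ω) ^ 2 = tiltDensity V ω ^ 2 + V ω ^ 2 + 1
      - 2 * (V ω * tiltDensity V ω) + 2 * V ω - 2 * tiltDensity V ω := by ring
  simp_rw [e]
  rw [integral_sub (by fun_prop) (by fun_prop), integral_add (by fun_prop) (by fun_prop),
    integral_sub (by fun_prop) (by fun_prop), integral_add (by fun_prop) (by fun_prop),
    integral_add (by fun_prop) (by fun_prop)]
  simp only [integral_const_mul, hV.integral_sq_tiltDensity, hV2, hV.integral_mul_tiltDensity,
    hV.integral_eq_zero, hV.integral_tiltDensity, integral_const, probReal_univ, smul_eq_mul]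
  ring

/-- The Cameron-Martin density is differentiable at `V = 0` in `L²`, with a quadratic remainder. -/
lemma abs_integral_mul_tiltDensity_sub_le [IsProbabilityMeasure P] (hV : IsCentredGaussian V)
    (h1 : ‖V‖ ≤ 1) (F : Lp ℝ 2 P) :
    |∫ ω, F ω * (tiltDensity V ω - 1 - V ω) ∂P| ≤ ‖F‖ * ‖V‖ ^ 2 := by
  have hg : MemLp (fun ω => tiltDensity V ω - 1 - V ω) 2 P :=
    (hV.memLp_tiltDensity.sub (memLp_const 1)).sub (Lp.memLp V)
  have h2 : ∫ ω, F ω * (tiltDensity V ω - 1 - V ω) ∂P = inner ℝ (hg.toLp _) F := by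
    rw [L2.inner_def]
    refine integral_congr_ae ?_
    filter_upwards [hg.coeFn_toLp] with ω hω
    simp [hω]
  have h3 : ‖hg.toLp _‖ ^ 2 = Real.exp (‖V‖ ^ 2) - 1 - ‖V‖ ^ 2 := by
    rw [← hV.integral_sq_tiltDensity_sub, ← real_inner_self_eq_norm_sq, L2.inner_def]
    refine integral_congr_ae ?_
    filter_upwards [hg.coeFn_toLp] with ω hω
    simp [hω, sq]
  have h4 : ‖hg.toLp _‖ ≤ ‖V‖ ^ 2 := by
    refine abs_le_of_sq_le_sq' ?_ (by positivity) |>.2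
    rw [h3]
    -- With s = ‖V‖² ≤ 1, the bound is |eˢ − 1 − s| ≤ s².
    have := Real.norm_exp_sub_one_sub_id_le (x := ‖V‖ ^ 2)
      (by rw [Real.norm_eq_abs, abs_of_nonneg (by positivity)]; exact pow_le_one₀ (norm_nonneg _) h1)
    simp only [Real.norm_eq_abs, sq_abs] at this
    exact (le_abs_self _).trans this
  rw [h2, mul_comm]
  exact (abs_real_inner_le_norm _ _).trans (by gcongr)

end IsCentredGaussian

end GaussianHilbert

/-! ### Indicators of initial intervals in `L₂[0, T]`. -/

section TimeIndicator

variable {T : ℝ}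

/-- The indicator of `[0, t]` as an element of the real space `L₂[0, T]`. -/
def timeIndicator (t : Icc (0 : ℝ) T) : Lp ℝ 2 (window T) :=
  indicatorConstLp 2 (measurableSet_Icc : MeasurableSet (Icc 0 (t : ℝ)))
    (measure_ne_top (window T) _) 1

lemma window_restrict_Icc (t : Icc (0 : ℝ) T) :
    (window T).restrict (Icc 0 (t : ℝ)) = volume.restrict (Icc 0 (t : ℝ)) := by
  rw [Measure.restrict_restrict measurableSet_Icc,
    inter_eq_left.2 (Icc_subset_Icc_right t.2.2)]

lemma inner_timeIndicator (t : Icc (0 : ℝ) T) (k : Lp ℝ 2 (window T)) :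
    inner ℝ (timeIndicator t) k = ∫ τ in (0 : ℝ)..t, k τ := by
  rw [timeIndicator, L2.inner_indicatorConstLp_one, window_restrict_Icc,
    intervalIntegral.integral_of_le t.2.1, integral_Icc_eq_integral_Ioc]

lemma inner_timeIndicator_timeIndicator (s t : Icc (0 : ℝ) T) :
    inner ℝ (timeIndicator s) (timeIndicator t) = min (s : ℝ) (t : ℝ) := by
  rw [timeIndicator, timeIndicator, L2.real_inner_indicatorConstLp_one_indicatorConstLp_one,
    Icc_inter_Icc, sup_idem, measureReal_restrict_apply measurableSet_Icc, inter_eq_left.2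
    (Icc_subset_Icc_right ((min_le_left _ _).trans s.2.2)), Real.volume_real_Icc_of_le
    (le_min s.2.1 t.2.1), sub_zero]

end TimeIndicator

/-! ### The Wiener integral. -/

namespace IsWienerProcess

variable {Ω : Type*} [MeasurableSpace Ω] {P : Measure Ω} {T : ℝ} {b : Icc (0 : ℝ) T → Ω → ℝ}

lemma memLp (hb : IsWienerProcess b P) (t : Icc (0 : ℝ) T) : MemLp (b t) 2 P :=
  (hb.gaussian.hasGaussianLaw_eval t).memLp_two

/-- The value at time `t` of a Wiener process, as an element of `L²(P)`. -/
def toLp (hb : IsWienerProcess b P) (t : Icc (0 : ℝ) T) : Lp ℝ 2 P := (hb.memLp t).toLp (b t)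

/-- Both sides are min(s, t). Equality of the two Gram matrices is what makes the correspondence
between `b t` and the indicator of [0, t] isometric. -/
lemma inner_toLp (hb : IsWienerProcess b P) (s t : Icc (0 : ℝ) T) :
    inner ℝ (hb.toLp s) (hb.toLp t) = inner ℝ (timeIndicator s) (timeIndicator t) := by
  have := hb.gaussian.isProbabilityMeasure
  rw [inner_timeIndicator_timeIndicator, ← hb.covariance_eq, covariance, L2.inner_def]
  refine integral_congr_ae ?_
  filter_upwards [(hb.memLp s).coeFn_toLp, (hb.memLp t).coeFn_toLp] with ω h1 h2
  rw [hb.mean_eq_zero, hb.mean_eq_zero, toLp, toLp, h1, h2]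
  simp [mul_comm]

/-- The finite linear combinations of the values of a Wiener process. -/
def linComb (hb : IsWienerProcess b P) : (Icc (0 : ℝ) T →₀ ℝ) →ₗ[ℝ] Lp ℝ 2 P :=
  Finsupp.linearCombination ℝ hb.toLp

lemma inner_linComb (hb : IsWienerProcess b P) (f g : Icc (0 : ℝ) T →₀ ℝ) :
    inner ℝ (hb.linComb f) (hb.linComb g) =
      inner ℝ (Finsupp.linearCombination ℝ timeIndicator f)
        (Finsupp.linearCombination ℝ timeIndicator g) := by
  simp only [linComb, Finsupp.linearCombination_apply, Finsupp.sum, sum_inner, inner_sum,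
    real_inner_smul_left, real_inner_smul_right, hb.inner_toLp]

lemma norm_linComb (hb : IsWienerProcess b P) (f : Icc (0 : ℝ) T →₀ ℝ) :
    ‖hb.linComb f‖ = ‖Finsupp.linearCombination ℝ timeIndicator f‖ := by
  rw [norm_eq_sqrt_real_inner, norm_eq_sqrt_real_inner, hb.inner_linComb]

lemma coeFn_linComb (hb : IsWienerProcess b P) (f : Icc (0 : ℝ) T →₀ ℝ) :
    hb.linComb f =ᵐ[P] fun ω => Finsupp.linearCombination ℝ (fun t => b t ω) f := by
  induction f using Finsupp.induction_linear with
  | zero =>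
    filter_upwards [Lp.coeFn_zero ℝ 2 P] with ω hω
    simpa using hω
  | add f g hf hg =>
    rw [map_add]
    filter_upwards [hf, hg, Lp.coeFn_add (hb.linComb f) (hb.linComb g)] with ω h1 h2 h3
    rw [h3, Pi.add_apply, h1, h2, map_add]
  | single t a =>
    rw [linComb, Finsupp.linearCombination_single]
    filter_upwards [Lp.coeFn_smul a (hb.toLp t), (hb.memLp t).coeFn_toLp] with ω h1 h2
    rw [h1, Pi.smul_apply, toLp, h2, Finsupp.linearCombination_single]

lemma isCentredGaussian_linComb (hb : IsWienerProcess b P) (f : Icc (0 : ℝ) T →₀ ℝ) :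
    IsCentredGaussian (hb.linComb f) := by
  let L : (f.support → ℝ) →L[ℝ] ℝ :=
    ∑ t : f.support, f t • ContinuousLinearMap.proj (R := ℝ) (φ := fun _ : f.support => ℝ) t
  have hL : (fun ω => L (f.support.restrict (b · ω))) =ᵐ[P] hb.linComb f := by
    filter_upwards [hb.coeFn_linComb f] with ω hω
    rw [hω, Finsupp.linearCombination_apply, Finsupp.sum, ← Finset.sum_coe_sort]
    simp [L]
  have hG : HasGaussianLaw (hb.linComb f) P :=
    ((hb.gaussian.hasGaussianLaw f.support).map_fun L).congr hL
  have hmean : ∫ ω, hb.linComb f ω ∂P = 0 := by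
    rw [integral_congr_ae (hb.coeFn_linComb f)]
    simp only [Finsupp.linearCombination_apply, Finsupp.sum, smul_eq_mul]
    have := hb.gaussian.isProbabilityMeasure
    rw [integral_finsetSum _ fun t _ => ((hb.memLp t).integrable (by norm_num)).const_mul _]
    simp [integral_const_mul, hb.mean_eq_zero]
  have hvar : Var[hb.linComb f; P] = ‖hb.linComb f‖ ^ 2 := by
    rw [variance_of_integral_eq_zero (aemeasurable_Lp _) hmean, ← real_inner_self_eq_norm_sq,
      L2.inner_def]
    simp [sq]
  rw [IsCentredGaussian, hG.map_eq_gaussianReal, hmean, hvar]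
  congr
  ext
  simp

/-- The Paley-Wiener map, which sends `k` to the Wiener integral `∫ k db`. -/
lemma exists_paleyWiener (hb : IsWienerProcess b P) :
    ∃ W : Lp ℝ 2 (window T) →L[ℝ] Lp ℝ 2 P, (∀ k, ‖W k‖ ≤ ‖k‖) ∧
      (∀ f k, inner ℝ (hb.linComb f) (W k) =
        inner ℝ (Finsupp.linearCombination ℝ timeIndicator f) k) ∧
      ∀ f k, IsCentredGaussian (hb.linComb f + W k) := by
  have := hb.gaussian.isProbabilityMeasure
  -- `H` is the Gaussian Hilbert space of the process: all its elements are centred Gaussian.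
  let H : Submodule ℝ (Lp ℝ 2 P) := (LinearMap.range hb.linComb).topologicalClosure
  have hHc : IsClosed (H : Set (Lp ℝ 2 P)) := Submodule.isClosed_topologicalClosure _
  have : CompleteSpace H := hHc.completeSpace_coe
  have hmem f : hb.linComb f ∈ H :=
    Submodule.le_topologicalClosure _ (LinearMap.mem_range_self _ f)
  have hH {V : Lp ℝ 2 P} (hV : V ∈ H) : IsCentredGaussian V := by
    refine closure_minimal ?_ isClosed_isCentredGaussian hV
    rintro _ ⟨f, rfl⟩
    exact hb.isCentredGaussian_linComb f
  let e : (Icc (0 : ℝ) T →₀ ℝ) →ₗ[ℝ] H := hb.linComb.codRestrict H hmem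
  have he : DenseRange e := by
    intro V
    rw [closure_subtype, ← range_comp]
    exact V.2
  have hle f : ‖Finsupp.linearCombination ℝ (timeIndicator (T := T)) f‖ ≤ 1 * ‖e f‖ := by
    rw [one_mul, ← hb.norm_linComb]
    rfl
  -- `D` sends `b t` to the indicator of [0, t], extended by density; the Wiener integral is its
  -- adjoint.
  let D : H →L[ℝ] Lp ℝ 2 (window T) :=
    (Finsupp.linearCombination ℝ (timeIndicator (T := T))).extendOfNorm e
  have hD : ‖D‖ ≤ 1 := LinearMap.opNorm_extendOfNorm_le he zero_le_one hle
  refine ⟨H.subtypeL ∘L D.adjoint, fun k => ?_, fun f k => ?_, fun f k => ?_⟩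
  · calc ‖D.adjoint k‖ ≤ ‖D.adjoint‖ * ‖k‖ := ContinuousLinearMap.le_opNorm _ _
      _ ≤ 1 * ‖k‖ := by
        rw [LinearIsometryEquiv.norm_map]
        gcongr
      _ = ‖k‖ := one_mul _
  · calc inner ℝ (hb.linComb f) (D.adjoint k : Lp ℝ 2 P) = inner ℝ (e f) (D.adjoint k) := rfl
      _ = inner ℝ (D (e f)) k := ContinuousLinearMap.adjoint_inner_right _ _ _
      _ = _ := by rw [LinearMap.extendOfNorm_eq he ⟨1, hle⟩]
  -- Joint Gaussianity comes for free, because the sum stays in `H`.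
  · exact hH (H.add_mem (hmem f) (D.adjoint k).2)

end IsWienerProcess

/-! ### Laws determined by moment generating functions and linear combinations. -/

/-- Two real random variables with the same moment generating function, finite everywhere, have the
same law. -/
lemma map_eq_of_mgf_eq {Ω Ω' : Type*} [MeasurableSpace Ω] [MeasurableSpace Ω'] {P : Measure Ω}
    {P' : Measure Ω'} [IsProbabilityMeasure P] [IsProbabilityMeasure P'] {X : Ω → ℝ} {Y : Ω' → ℝ}
    (hX : AEMeasurable X P) (hY : AEMeasurable Y P') (h : mgf X P = mgf Y P')
    (hpos : ∀ t, 0 < mgf X P t) : P.map X = P'.map Y := by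
  refine Measure.ext_of_complexMGF_eq hX hY (funext fun z => eqOn_complexMGF_of_mgf h ?_)
  -- `mgf` takes the default value 0 where the exponential is not integrable, so positivity encodes
  -- finiteness.
  have : integrableExpSet X P = univ := eq_univ_of_forall fun t => mgf_pos_iff.1 (hpos t)
  simp [this]

/-- The law of a real process is determined by those of its finite linear combinations. -/
lemma map_process_eq {ι Ω Ω' : Type*} [MeasurableSpace Ω] [MeasurableSpace Ω'] {P : Measure Ω}
    {P' : Measure Ω'} [IsProbabilityMeasure P] [IsProbabilityMeasure P'] {X : ι → Ω → ℝ}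
    {Y : ι → Ω' → ℝ} (hX : ∀ i, Measurable (X i)) (hY : ∀ i, Measurable (Y i))
    (h : ∀ f : ι →₀ ℝ, P.map (fun ω => Finsupp.linearCombination ℝ (X · ω) f) =
      P'.map (fun ω => Finsupp.linearCombination ℝ (Y · ω) f)) :
    P.map (fun ω i => X i ω) = P'.map (fun ω i => Y i ω) := by
  have hXm : Measurable fun ω i => X i ω := measurable_pi_lambda _ hX
  have hYm : Measurable fun ω i => Y i ω := measurable_pi_lambda _ hY
  have : IsProbabilityMeasure (P'.map fun ω i => Y i ω) :=
    Measure.isProbabilityMeasure_map hYm.aemeasurable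
  have : IsProbabilityMeasure (P.map fun ω i => X i ω) :=
    Measure.isProbabilityMeasure_map hXm.aemeasurable
  have hr (I : Finset ι) : Measurable (I.restrict (π := fun _ => ℝ)) := Finset.measurable_restrict I
  have hp (I : Finset ι) : IsFiniteMeasure ((P'.map fun ω i => Y i ω).map I.restrict) :=
    Measure.isFiniteMeasure_map _ _
  refine IsProjectiveLimit.unique (P := fun I => (P'.map fun ω i => Y i ω).map I.restrict)
    (fun I => ?_) (fun I => rfl)
  classical
  -- Cramér–Wold: a finite-dimensional marginal is determined by the laws of its linear functionals.
  refine Measure.ext_of_charFunDual (funext fun L => ?_)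
  have hL (x : ι → ℝ) : L (I.restrict x) = Finsupp.linearCombination ℝ x
      (∑ i : I, Finsupp.single (i : ι) (L fun j => if i = j then 1 else 0)) := by
    rw [map_sum]
    simp only [Finsupp.linearCombination_single]
    exact (LinearMap.pi_apply_eq_sum_univ L.toLinearMap (I.restrict x)).trans
      (Finset.sum_congr rfl fun i _ => mul_comm _ _)
  rw [charFunDual_eq_charFun_map_one, charFunDual_eq_charFun_map_one,
    Measure.map_map L.measurable (hr I), Measure.map_map L.measurable (hr I),
    Measure.map_map (L.measurable.comp (hr I)) hXm, Measure.map_map (L.measurable.comp (hr I)) hYm]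
  have e1 : ((L ∘ I.restrict) ∘ fun ω i => X i ω) = _ := funext fun ω => hL (X · ω)
  have e2 : ((L ∘ I.restrict) ∘ fun ω i => Y i ω) = _ := funext fun ω => hL (Y · ω)
  rw [e1, e2, h]

/-! ### Cameron–Martin change of measure. -/

section ChangeOfMeasure

variable {Ω : Type*} [MeasurableSpace Ω] {P P' : Measure Ω} {T σ : ℝ}
  {b b' : Icc (0 : ℝ) T → Ω → ℝ} {Z : Icc (0 : ℝ) T → Ω → ℝ} {x x' : Lp ℝ 2 (window T)}

lemma linearCombination_observation (hb : IsWienerProcess b P)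
    (hZ : ∀ᵐ ω ∂P, ∀ t, Z t ω = inner ℝ (timeIndicator t) x + σ * b t ω)
    (f : Icc (0 : ℝ) T →₀ ℝ) :
    (fun ω => Finsupp.linearCombination ℝ (Z · ω) f) =ᵐ[P] fun ω =>
      inner ℝ (Finsupp.linearCombination ℝ timeIndicator f) x + σ * hb.linComb f ω := by
  filter_upwards [hZ, hb.coeFn_linComb f] with ω h1 h2
  rw [h2]
  simp only [Finsupp.linearCombination_apply, Finsupp.sum, sum_inner, real_inner_smul_left, h1,
    smul_eq_mul, mul_add, Finset.sum_add_distrib, Finset.mul_sum]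
  congr 1
  exact Finset.sum_congr rfl fun t _ => by ring

lemma mgf_observation (hb : IsWienerProcess b P)
    (hZ : ∀ᵐ ω ∂P, ∀ t, Z t ω = inner ℝ (timeIndicator t) x + σ * b t ω)
    (f : Icc (0 : ℝ) T →₀ ℝ) (s : ℝ) :
    mgf (fun ω => Finsupp.linearCombination ℝ (Z · ω) f) P s =
      Real.exp (s * inner ℝ (Finsupp.linearCombination ℝ timeIndicator f) x +
        (s * σ) ^ 2 * ‖Finsupp.linearCombination ℝ (timeIndicator (T := T)) f‖ ^ 2 / 2) := by
  have h := (hb.isCentredGaussian_linComb f).mgf_eq (s * σ)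
  rw [mgf_congr (linearCombination_observation hb hZ f), mgf]
  simp_rw [mul_add, Real.exp_add, ← mul_assoc s σ]
  rw [integral_const_mul, ← mgf, h, hb.norm_linComb]
  ring_nf

/-- The Cameron-Martin theorem: tilting by a Wiener integral changes the observed signal. -/
lemma map_tilted_observation (hσ : σ ≠ 0) (hZm : ∀ t, Measurable (Z t))
    (hb : IsWienerProcess b P) (hb' : IsWienerProcess b' P')
    (hZ : ∀ᵐ ω ∂P, ∀ t, Z t ω = inner ℝ (timeIndicator t) x + σ * b t ω)
    (hZ' : ∀ᵐ ω ∂P', ∀ t, Z t ω = inner ℝ (timeIndicator t) x' + σ * b' t ω)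
    {V : Lp ℝ 2 P} (hV : ∀ f, IsCentredGaussian (hb.linComb f + V))
    (hbV : ∀ f, inner ℝ (hb.linComb f) V =
      inner ℝ (Finsupp.linearCombination ℝ timeIndicator f) (σ⁻¹ • (x' - x))) :
    (P.tilted V).map (fun ω t => Z t ω) = P'.map (fun ω t => Z t ω) := by
  have := hb.gaussian.isProbabilityMeasure
  have := hb'.gaussian.isProbabilityMeasure
  have hV0 : IsCentredGaussian V := by simpa using hV 0
  have : IsProbabilityMeasure (P.tilted V) := isProbabilityMeasure_tilted hV0.integrable_exp
  refine map_process_eq hZm hZm fun f => ?_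
  have hm : Measurable fun ω => Finsupp.linearCombination ℝ (Z · ω) f := by
    simp only [Finsupp.linearCombination_apply, Finsupp.sum]
    fun_prop
  have hQ : mgf (fun ω => Finsupp.linearCombination ℝ (Z · ω) f) (P.tilted V) =
      mgf (fun ω => Finsupp.linearCombination ℝ (Z · ω) f) P' := by
    funext s
    rw [mgf_observation hb' hZ' f s, mgf, integral_tilted, hV0.integral_exp]
    -- The exponent under the tilt is again centred Gaussian. The cross term of its squared norm
    -- contributes s⟨f, x' − x⟩, which replaces the mean signal x by x'.
    have hG := (hV ((s * σ) • f)).integral_exp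
    rw [map_smul, norm_add_sq_real, norm_smul, real_inner_smul_left, hbV, real_inner_smul_right,
      hb.norm_linComb] at hG
    have e : (fun ω => (Real.exp (V ω) / Real.exp (‖V‖ ^ 2 / 2)) •
        Real.exp (s * Finsupp.linearCombination ℝ (Z · ω) f)) =ᵐ[P] fun ω =>
        Real.exp (s * inner ℝ (Finsupp.linearCombination ℝ timeIndicator f) x - ‖V‖ ^ 2 / 2) *
          Real.exp (((s * σ) • hb.linComb f + V : Lp ℝ 2 P) ω) := by
      filter_upwards [linearCombination_observation hb hZ f,
        Lp.coeFn_add ((s * σ) • hb.linComb f) V, Lp.coeFn_smul (s * σ) (hb.linComb f)]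
        with ω h1 h2 h3
      rw [h1, h2, Pi.add_apply, h3, Pi.smul_apply, smul_eq_mul, smul_eq_mul, ← Real.exp_sub,
        ← Real.exp_add, ← Real.exp_add]
      ring_nf
    rw [integral_congr_ae e, integral_const_mul, hG, ← Real.exp_add, inner_sub_right, mul_pow,
      Real.norm_eq_abs, sq_abs]
    congr 1
    field_simp
    ring
  refine map_eq_of_mgf_eq hm.aemeasurable hm.aemeasurable hQ fun t => ?_
  rw [hQ, mgf_observation hb' hZ' f t]
  exact Real.exp_pos _

end ChangeOfMeasure

/-! ### The Cramér–Rao bound for real signals. -/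

section RealSignals

variable {Ω : Type*} [MeasurableSpace Ω] {P P' : Measure Ω} {T σ : ℝ}
  {b b' : Icc (0 : ℝ) T → Ω → ℝ} {Z : Icc (0 : ℝ) T → Ω → ℝ} {x x' : Lp ℝ 2 (window T)}

/-- Only the laws of the path agree under the tilted measure and `P'`, so `F` must be a function of
the path. No integrability is needed: both sides integrate `F` against the same law. -/
lemma integral_observation_eq (hσ : σ ≠ 0) (hZm : ∀ t, Measurable (Z t))
    (hb : IsWienerProcess b P) (hb' : IsWienerProcess b' P')
    (hZ : ∀ᵐ ω ∂P, ∀ t, Z t ω = inner ℝ (timeIndicator t) x + σ * b t ω)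
    (hZ' : ∀ᵐ ω ∂P', ∀ t, Z t ω = inner ℝ (timeIndicator t) x' + σ * b' t ω)
    {V : Lp ℝ 2 P} (hV : ∀ f, IsCentredGaussian (hb.linComb f + V))
    (hbV : ∀ f, inner ℝ (hb.linComb f) V =
      inner ℝ (Finsupp.linearCombination ℝ timeIndicator f) (σ⁻¹ • (x' - x)))
    {F : (Icc (0 : ℝ) T → ℝ) → ℝ} (hF : Measurable F) :
    ∫ ω, F (Z · ω) ∂P' = ∫ ω, F (Z · ω) * tiltDensity V ω ∂P := by
  have hV0 : IsCentredGaussian V := by simpa using hV 0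
  have hm : Measurable fun ω t => Z t ω := measurable_pi_lambda _ hZm
  have h1 := integral_map (μ := P') (φ := fun ω t => Z t ω) hm.aemeasurable
    hF.aestronglyMeasurable
  have h2 := integral_map (μ := P.tilted V) (φ := fun ω t => Z t ω) hm.aemeasurable
    hF.aestronglyMeasurable
  rw [← h1, ← map_tilted_observation hσ hZm hb hb' hZ hZ' hV hbV, h2, integral_tilted,
    hV0.integral_exp]
  refine integral_congr_ae (.of_forall fun ω => ?_)
  simp only [tiltDensity, Real.exp_sub, smul_eq_mul]
  ring

/-- The covariance of an unbiased scalar estimator of `⟨f, H θ⟩` with the score in the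
direction `v`. -/
lemma inner_paleyWiener_fderiv {K : ℕ} {Θ : Set (Param K)} (hΘ : IsOpen Θ)
    {H : Param K → Lp ℝ 2 (window T)} {dH : Param K →L[ℝ] Lp ℝ 2 (window T)} {θ : Param K}
    (hθ : θ ∈ Θ) (hH : HasFDerivAt H dH θ) (hσ : σ ≠ 0) {P : Param K → Measure Ω}
    (hZm : ∀ t, Measurable (Z t))
    (hobs : ∀ φ ∈ Θ, ∃ b : Icc (0 : ℝ) T → Ω → ℝ, IsWienerProcess b (P φ) ∧
      ∀ᵐ ω ∂(P φ), ∀ t, Z t ω = inner ℝ (timeIndicator t) (H φ) + σ * b t ω)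
    {b : Icc (0 : ℝ) T → Ω → ℝ} (hb : IsWienerProcess b (P θ))
    (hZ : ∀ᵐ ω ∂(P θ), ∀ t, Z t ω = inner ℝ (timeIndicator t) (H θ) + σ * b t ω)
    {W : Lp ℝ 2 (window T) →L[ℝ] Lp ℝ 2 (P θ)} (hWn : ∀ k, ‖W k‖ ≤ ‖k‖)
    (hbW : ∀ f k, inner ℝ (hb.linComb f) (W k) =
      inner ℝ (Finsupp.linearCombination ℝ timeIndicator f) k)
    (hW : ∀ f k, IsCentredGaussian (hb.linComb f + W k))
    {F : (Icc (0 : ℝ) T → ℝ) → ℝ} (hF : Measurable F)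
    (hF2 : MemLp (fun ω => F (Z · ω)) 2 (P θ)) (f : Lp ℝ 2 (window T))
    (hunb : ∀ φ ∈ Θ, ∫ ω, F (Z · ω) ∂(P φ) = inner ℝ f (H φ)) (v : Param K) :
    ∫ ω, F (Z · ω) * W (dH v) ω ∂(P θ) = σ * inner ℝ f (dH v) := by
  have := hb.gaussian.isProbabilityMeasure
  set G : Lp ℝ 2 (P θ) := hF2.toLp _ with hGdef
  have hG : G =ᵐ[P θ] fun ω => F (Z · ω) := hF2.coeFn_toLp
  -- The claim is that `ℓ` vanishes on the range of `dH`. Unbiasedness makes `ℓ (H φ - H θ)`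
  -- quadratically small, so the derivative of `ℓ ∘ H` at θ, namely `ℓ ∘ dH`, is zero.
  let ℓ : Lp ℝ 2 (window T) →L[ℝ] ℝ := σ⁻¹ • (innerSL ℝ G ∘L W) - innerSL ℝ f
  have hℓ k : ℓ k = σ⁻¹ * inner ℝ G (W k) - inner ℝ f k := rfl
  have hkey φ (hφ : φ ∈ Θ) (hsmall : ‖σ⁻¹ • (H φ - H θ)‖ ≤ 1) :
      ‖ℓ (H φ - H θ)‖ ≤ ‖G‖ * ‖σ⁻¹ • (H φ - H θ)‖ ^ 2 := by
    obtain ⟨b', hb', hZ'⟩ := hobs φ hφ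
    set V := W (σ⁻¹ • (H φ - H θ)) with hVdef
    have hV0 : IsCentredGaussian V := by
      have := hW 0 (σ⁻¹ • (H φ - H θ))
      rwa [map_zero, zero_add] at this
    have h1 := integral_observation_eq hσ hZm hb hb' hZ hZ' (fun f => hW f _)
      (fun f => hbW f _) hF
    rw [hunb φ hφ, ← hVdef] at h1
    have i1 : Integrable (fun ω => F (Z · ω) * tiltDensity V ω) (P θ) :=
      hF2.integrable_mul hV0.memLp_tiltDensity
    have i2 : Integrable (fun ω => F (Z · ω)) (P θ) := hF2.integrable (by norm_num)
    have i3 : Integrable (fun ω => F (Z · ω) * V ω) (P θ) := hF2.integrable_mul (Lp.memLp V)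
    have i4 : Integrable (fun ω => F (Z · ω) * tiltDensity V ω - F (Z · ω)) (P θ) := i1.sub i2
    have h2 : inner ℝ G V = ∫ ω, F (Z · ω) * V ω ∂(P θ) := by
      rw [L2.inner_def]
      refine integral_congr_ae ?_
      filter_upwards [hG] with ω hω
      simp [hω, mul_comm]
    have h3 : ∫ ω, G ω * (tiltDensity V ω - 1 - V ω) ∂(P θ) = -ℓ (H φ - H θ) := by
      have e : (fun ω => G ω * (tiltDensity V ω - 1 - V ω)) =ᵐ[P θ] fun ω =>
          F (Z · ω) * tiltDensity V ω - F (Z · ω) - F (Z · ω) * V ω := by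
        filter_upwards [hG] with ω hω
        rw [hω]
        ring
      rw [integral_congr_ae e, integral_sub i4 i3, integral_sub i1 i2, ← h1, ← h2,
        hunb θ hθ, hℓ, hVdef, map_smul, real_inner_smul_right, inner_sub_right]
      ring
    have hVn : ‖V‖ ≤ ‖σ⁻¹ • (H φ - H θ)‖ := hWn _
    have h4 := hV0.abs_integral_mul_tiltDensity_sub_le (hVn.trans hsmall) G
    rw [h3, abs_neg] at h4
    exact h4.trans (by gcongr)
  have hu : HasFDerivAt (fun φ => ℓ (H φ)) (ℓ ∘L dH) θ := ℓ.hasFDerivAt.comp θ hH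
  have hu0 : HasFDerivAt (fun φ => ℓ (H φ)) (0 : Param K →L[ℝ] ℝ) θ := by
    rw [hasFDerivAt_iff_isLittleO]
    have hlim : Filter.Tendsto (fun φ => H φ - H θ) (nhds θ) (nhds 0) := by
      simpa using hH.continuousAt.tendsto.sub_const (H θ)
    have hO : (fun φ => ℓ (H φ) - ℓ (H θ) - (0 : Param K →L[ℝ] ℝ) (φ - θ)) =O[nhds θ]
        fun φ => ‖H φ - H θ‖ * ‖H φ - H θ‖ := by
      refine Asymptotics.IsBigO.of_bound (‖G‖ * ‖σ⁻¹‖ ^ 2) ?_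
      have hev : ∀ᶠ φ in nhds θ, ‖σ⁻¹ • (H φ - H θ)‖ < 1 := by
        have : Filter.Tendsto (fun φ => ‖σ⁻¹ • (H φ - H θ)‖) (nhds θ) (nhds 0) := by
          simpa using (hlim.const_smul σ⁻¹).norm
        exact this.eventually (gt_mem_nhds one_pos)
      filter_upwards [hev, hΘ.mem_nhds hθ] with φ h1 h2
      have := hkey φ h2 h1.le
      rw [norm_smul] at this
      rw [zero_apply, sub_zero, ← map_sub]
      refine this.trans_eq ?_
      rw [Real.norm_of_nonneg (by positivity : 0 ≤ ‖H φ - H θ‖ * ‖H φ - H θ‖)]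
      ring
    refine hO.trans_isLittleO ?_
    have ho : (fun φ => ‖H φ - H θ‖) =o[nhds θ] fun _ => (1 : ℝ) := by
      rw [Asymptotics.isLittleO_one_iff]
      simpa using hlim.norm
    simpa using ho.mul_isBigO hH.isBigO_sub.norm_norm |>.norm_right
  have h0 : ℓ (dH v) = 0 := by
    have := congrArg (fun L : Param K →L[ℝ] ℝ => L v) (hu.unique hu0)
    simpa using this
  rw [hℓ, sub_eq_zero, L2.inner_def] at h0
  rw [← h0, mul_inv_cancel_left₀ hσ]
  refine integral_congr_ae ?_
  filter_upwards [hG] with ω hω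
  simp [hω, mul_comm]

/-- The Cramér-Rao bound for real signals in white Gaussian noise. -/
theorem cramerRao_real {K : ℕ} {Θ : Set (Param K)} (hΘ : IsOpen Θ)
    {H : Param K → Lp ℝ 2 (window T)} {dH : Param K →L[ℝ] Lp ℝ 2 (window T)} {θ : Param K}
    (hθ : θ ∈ Θ) (hH : HasFDerivAt H dH θ) (hinj : ∀ v, dH v = 0 → v = 0) (hσ : 0 < σ)
    {P : Param K → Measure Ω} (hZm : ∀ t, Measurable (Z t))
    (hobs : ∀ φ ∈ Θ, ∃ b : Icc (0 : ℝ) T → Ω → ℝ, IsWienerProcess b (P φ) ∧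
      ∀ᵐ ω ∂(P φ), ∀ t, Z t ω = inner ℝ (timeIndicator t) (H φ) + σ * b t ω)
    {X : (Icc (0 : ℝ) T → ℝ) → Lp ℝ 2 (window T)} (hX : StronglyMeasurable X)
    (hX2 : MemLp (fun ω => X (Z · ω)) 2 (P θ))
    (hunb : ∀ φ ∈ Θ, ∀ f, ∫ ω, inner ℝ f (X (Z · ω)) ∂(P φ) = inner ℝ f (H φ)) :
    ENNReal.ofReal (K * σ ^ 2) ≤ ∫⁻ ω, ‖X (Z · ω) - H θ‖ₑ ^ 2 ∂(P θ) := by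
  obtain ⟨b, hb, hZ⟩ := hobs θ hθ
  have := hb.gaussian.isProbabilityMeasure
  obtain ⟨W, hWn, hbW, hW⟩ := hb.exists_paleyWiener
  let R : Submodule ℝ (Lp ℝ 2 (window T)) := LinearMap.range dH.toLinearMap
  have hR : Module.finrank ℝ R = K := by
    rw [LinearMap.finrank_range_of_inj]
    · simp
    · exact (injective_iff_map_eq_zero dH).2 hinj
  -- Orthonormal directions in the tangent space, rather than parameter coordinates, avoid inverting
  -- a Fisher information matrix.
  let u := stdOrthonormalBasis ℝ R
  have hu : Orthonormal ℝ fun i => (u i : Lp ℝ 2 (window T)) :=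
    u.orthonormal.comp_linearIsometry R.subtypeₗᵢ
  have hdir i : ENNReal.ofReal (σ ^ 2) ≤
      ∫⁻ ω, ‖inner ℝ (u i : Lp ℝ 2 (window T)) (X (Z · ω) - H θ)‖ₑ ^ 2 ∂(P θ) := by
    obtain ⟨v, hv⟩ := (u i).2
    have hv : dH v = u i := hv
    have hun : ‖(u i : Lp ℝ 2 (window T))‖ = 1 := hu.1 i
    have hF : Measurable fun y => inner ℝ (u i : Lp ℝ 2 (window T)) (X y) :=
      ((innerSL ℝ (u i : Lp ℝ 2 (window T))).continuous.comp_stronglyMeasurable hX).measurable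
    have hF2 : MemLp (fun ω => inner ℝ (u i : Lp ℝ 2 (window T)) (X (Z · ω))) 2 (P θ) :=
      hX2.const_inner _
    have hcov := inner_paleyWiener_fderiv hΘ hθ hH hσ.ne' hZm hobs hb hZ hWn hbW hW hF hF2
      (u i) (fun φ hφ => hunb φ hφ _) v
    rw [hv, real_inner_self_eq_norm_sq, hun, one_pow, mul_one] at hcov
    have hM : MemLp (fun ω => inner ℝ (u i : Lp ℝ 2 (window T)) (X (Z · ω) - H θ)) 2 (P θ) :=
      (hX2.sub (memLp_const _)).const_inner _
    -- The score has mean zero, so centring the estimator at `H θ` does not change the covariance.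
    have hWz : ∫ ω, W (u i) ω ∂(P θ) = 0 :=
      IsCentredGaussian.integral_eq_zero (by simpa using hW 0 (u i))
    have hinner : inner ℝ (hM.toLp _) (W (u i)) = σ := by
      rw [L2.inner_def, ← hcov]
      have e : (fun ω => inner ℝ (hM.toLp _ ω) (W (u i) ω)) =ᵐ[P θ] fun ω =>
          inner ℝ (u i : Lp ℝ 2 (window T)) (X (Z · ω)) * W (u i) ω -
            inner ℝ (u i : Lp ℝ 2 (window T)) (H θ) * W (u i) ω := by
        filter_upwards [hM.coeFn_toLp] with ω hω
        rw [hω, inner_sub_right]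
        simp only [RCLike.inner_apply, conj_trivial]
        ring
      have hi : Integrable (fun ω => inner ℝ (u i : Lp ℝ 2 (window T)) (X (Z · ω)) *
          W (u i) ω) (P θ) := hF2.integrable_mul (Lp.memLp _)
      rw [integral_congr_ae e, integral_sub hi
        (((Lp.memLp (W (u i))).integrable (by norm_num)).const_mul _), integral_const_mul, hWz,
        mul_zero, sub_zero]
    have hle : σ ≤ ‖hM.toLp _‖ := by
      calc σ = inner ℝ (hM.toLp _) (W (u i)) := hinner.symm
        _ ≤ ‖hM.toLp _‖ * ‖W (u i)‖ := real_inner_le_norm _ _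
        _ ≤ ‖hM.toLp _‖ * 1 := by
          gcongr
          exact (hWn _).trans_eq hun
        _ = _ := mul_one _
    have hnorm : ENNReal.ofReal σ ≤
        eLpNorm (fun ω => inner ℝ (u i : Lp ℝ 2 (window T)) (X (Z · ω) - H θ)) 2 (P θ) := by
      rw [Lp.norm_toLp] at hle
      exact ENNReal.ofReal_le_of_le_toReal hle
    rw [ENNReal.ofReal_pow hσ.le]
    calc ENNReal.ofReal σ ^ 2 ≤ _ := pow_le_pow_left' hnorm 2
      _ = _ := by
        have := eLpNorm_nnreal_pow_eq_lintegral (μ := P θ) (p := 2)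
          (f := fun ω => inner ℝ (u i : Lp ℝ 2 (window T)) (X (Z · ω) - H θ)) (by norm_num)
        simpa using this
  calc ENNReal.ofReal (K * σ ^ 2)
      = ∑ _i : Fin (Module.finrank ℝ R), ENNReal.ofReal (σ ^ 2) := by
        rw [ENNReal.ofReal_mul (by positivity)]
        simp [hR]
    _ ≤ ∑ i, ∫⁻ ω, ‖inner ℝ (u i : Lp ℝ 2 (window T)) (X (Z · ω) - H θ)‖ₑ ^ 2 ∂(P θ) :=
        Finset.sum_le_sum fun i _ => hdir i
    _ = ∫⁻ ω, ∑ i, ‖inner ℝ (u i : Lp ℝ 2 (window T)) (X (Z · ω) - H θ)‖ₑ ^ 2 ∂(P θ) := by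
        rw [lintegral_finsetSum' _ fun i _ => ?_]
        exact ((hX2.sub (memLp_const _)).const_inner (𝕜 := ℝ) _).1.enorm.pow_const _
    _ ≤ ∫⁻ ω, ‖X (Z · ω) - H θ‖ₑ ^ 2 ∂(P θ) := by
        refine lintegral_mono fun ω => ?_
        -- Bessel's inequality, pointwise in ω.
        have h := hu.sum_inner_products_le (X (Z · ω) - H θ) (s := Finset.univ)
        have h' := ENNReal.ofReal_le_ofReal h
        rw [ENNReal.ofReal_sum_of_nonneg fun i _ => by positivity] at h'
        simpa only [ENNReal.ofReal_pow (norm_nonneg _), ofReal_norm] using h'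

end RealSignals

/-! ### Reduction from complex to real signals. -/

section ComplexSignals

variable {T : ℝ}

/-- The real part of a complex signal. -/
def rePart (T : ℝ) : L2 T →L[ℝ] Lp ℝ 2 (window T) := Complex.reCLM.compLpL 2 (window T)

/-- The imaginary part of a complex signal. -/
def imPart (T : ℝ) : L2 T →L[ℝ] Lp ℝ 2 (window T) := Complex.imCLM.compLpL 2 (window T)

lemma coeFn_rePart (g : L2 T) : rePart T g =ᵐ[window T] fun τ => (g τ).re :=
  Complex.reCLM.coeFn_compLpL g

lemma coeFn_imPart (g : L2 T) : imPart T g =ᵐ[window T] fun τ => (g τ).im :=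
  Complex.imCLM.coeFn_compLpL g

lemma enorm_rePart_le (g : L2 T) : ‖rePart T g‖ₑ ≤ ‖g‖ₑ := by
  rw [enorm_le_iff_norm_le]
  calc ‖rePart T g‖ ≤ ‖Complex.reCLM‖ * ‖g‖ := Complex.reCLM.norm_compLp_le g
    _ = ‖g‖ := by rw [Complex.reCLM_norm, one_mul]

lemma eq_zero_of_rePart_imPart {g : L2 T} (h1 : rePart T g = 0) (h2 : imPart T g = 0) : g = 0 := by
  refine Lp.ext ?_
  have e1 := coeFn_rePart g
  have e2 := coeFn_imPart g
  rw [h1] at e1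
  rw [h2] at e2
  filter_upwards [e1, e2, Lp.coeFn_zero ℝ 2 (window T), Lp.coeFn_zero ℂ 2 (window T)]
    with τ h1 h2 h3 h4
  rw [h4]
  rw [h3] at h1 h2
  exact Complex.ext h1.symm h2.symm

lemma imPart_eq_zero {g : L2 T} (h : ∀ᵐ t ∂(window T), (g t).im = 0) : imPart T g = 0 := by
  refine Lp.ext ?_
  filter_upwards [coeFn_imPart g, h, Lp.coeFn_zero ℝ 2 (window T)] with τ h1 h2 h3
  rw [h1, h2, h3]
  rfl

/-- It turns unbiasedness of the complex estimator, tested on real-valued functions, into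
unbiasedness of its real part. -/
lemma inner_rePart (f : Lp ℝ 2 (window T)) (g : L2 T) :
    inner ℝ f (rePart T g) = (inner ℂ (Complex.ofRealCLM.compLpL 2 (window T) f) g).re := by
  rw [L2.inner_def, L2.inner_def, ← Complex.reCLM_apply,
    ← Complex.reCLM.integral_comp_comm (L2.integrable_inner _ _)]
  refine integral_congr_ae ?_
  filter_upwards [coeFn_rePart g, Complex.ofRealCLM.coeFn_compLpL (p := 2) (μ := window T) f]
    with τ h1 h2
  rw [h1, h2]
  simp

lemma intervalIntegrable_L2 (g : L2 T) (t : Icc (0 : ℝ) T) :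
    IntervalIntegrable g volume 0 t := by
  rw [intervalIntegrable_iff_integrableOn_Icc_of_le t.2.1]
  have h : IntegrableOn g (Icc 0 T) volume := (Lp.memLp g).integrable (by norm_num)
  exact h.mono_set (Icc_subset_Icc_right t.2.2)

lemma ae_interval_of_ae_window {p : ℝ → Prop} (h : ∀ᵐ τ ∂(window T), p τ) (t : Icc (0 : ℝ) T) :
    ∀ᵐ τ, τ ∈ uIoc 0 (t : ℝ) → p τ := by
  rw [ae_restrict_iff' measurableSet_Icc] at h
  filter_upwards [h] with τ hτ hmem
  rw [uIoc_of_le t.2.1] at hmem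
  exact hτ ⟨hmem.1.le, hmem.2.trans t.2.2⟩

lemma re_integral_L2 (g : L2 T) (t : Icc (0 : ℝ) T) :
    (∫ τ in (0 : ℝ)..t, g τ).re = inner ℝ (timeIndicator t) (rePart T g) := by
  rw [inner_timeIndicator, ← Complex.reCLM_apply,
    ← Complex.reCLM.intervalIntegral_comp_comm (intervalIntegrable_L2 g t)]
  exact (intervalIntegral.integral_congr_ae (ae_interval_of_ae_window (coeFn_rePart g) t)).symm

lemma im_integral_L2 {g : L2 T} (h : ∀ᵐ t ∂(window T), (g t).im = 0) (t : Icc (0 : ℝ) T) :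
    (∫ τ in (0 : ℝ)..t, g τ).im = 0 := by
  rw [← Complex.imCLM_apply, ← Complex.imCLM.intervalIntegral_comp_comm (intervalIntegrable_L2 g t)]
  exact (intervalIntegral.integral_congr_ae (g := fun _ => 0)
    (ae_interval_of_ae_window h t)).trans intervalIntegral.integral_zero

/-- The Cramér-Rao bound for signals in white Gaussian noise. -/
theorem cramerRao {K : ℕ} {σ : ℝ} (hσ : 0 < σ) {Θ : Set (Param K)} (hΘ : IsOpen Θ)
    {h : Param K → L2 T} (h_real : ∀ θ ∈ Θ, ∀ᵐ t ∂(window T), (h θ t).im = 0)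
    {Ω : Type*} [MeasurableSpace Ω] {P : Param K → Measure Ω}
    {z : Icc (0 : ℝ) T → Ω → ℂ} (hz : ∀ t, Measurable (z t))
    (h_obs : ∀ θ ∈ Θ, IsNoisyObservation σ (h θ) z (P θ))
    {xhat : Estimator T} (h_meas : StronglyMeasurable xhat)
    (h_unb : IsUnbiased Θ h P z xhat)
    {θ : Param K} (hθ : θ ∈ Θ) {dh : Param K →L[ℝ] L2 T} (h_diff : HasFDerivAt h dh θ)
    (h_null : ∀ v, dh v = 0 → v = 0)
    (h_var : ∫⁻ ω, ‖xhat fun t => z t ω‖ₑ ^ 2 ∂(P θ) < ∞) :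
    ENNReal.ofReal (K * σ ^ 2) ≤ mse (P θ) z xhat (h θ) := by
  have hobs : ∀ φ ∈ Θ, ∃ b : Icc (0 : ℝ) T → Ω → ℝ, IsWienerProcess b (P φ) ∧
      ∀ᵐ ω ∂(P φ), ∀ t, (z t ω).re = inner ℝ (timeIndicator t) (rePart T (h φ)) + σ * b t ω := by
    intro φ hφ
    obtain ⟨b, hb, hzb⟩ := h_obs φ hφ
    refine ⟨b, hb, ?_⟩
    filter_upwards [hzb] with ω hω t
    rw [hω t, Complex.add_re, re_integral_L2, Complex.re_ofReal_mul, Complex.ofReal_re]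
  have hzre : ∀ φ ∈ Θ, ∀ᵐ ω ∂(P φ), (fun t => ((z t ω).re : ℂ)) = fun t => z t ω := by
    intro φ hφ
    obtain ⟨b, hb, hzb⟩ := h_obs φ hφ
    filter_upwards [hzb] with ω hω
    funext t
    refine Complex.ext (Complex.ofReal_re _) ?_
    rw [Complex.ofReal_im, hω t, Complex.add_im, im_integral_L2 (h_real φ hφ),
      Complex.im_ofReal_mul, Complex.ofReal_im, mul_zero, add_zero]
  have hdiff : HasFDerivAt (fun φ => rePart T (h φ)) (rePart T ∘L dh) θ :=
    (rePart T).hasFDerivAt.comp θ h_diff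
  have himd : imPart T ∘L dh = 0 := by
    have h1 : HasFDerivAt (fun φ => imPart T (h φ)) (imPart T ∘L dh) θ :=
      (imPart T).hasFDerivAt.comp θ h_diff
    -- The imaginary part of `h` vanishes on the open set Θ, a neighbourhood of θ. Hence the real
    -- part of `dh` already has trivial null space.
    refine h1.unique ((hasFDerivAt_const (0 : Lp ℝ 2 (window T)) θ).congr_of_eventuallyEq ?_)
    filter_upwards [hΘ.mem_nhds hθ] with φ hφ using imPart_eq_zero (h_real φ hφ)
  have hinj : ∀ v, (rePart T ∘L dh) v = 0 → v = 0 := fun v hv =>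
    h_null v (eq_zero_of_rePart_imPart hv (congrArg (fun L => L v) himd))
  -- The observed path is almost surely real, so feeding back only its real part loses nothing.
  let X : (Icc (0 : ℝ) T → ℝ) → Lp ℝ 2 (window T) := fun y => rePart T (xhat fun t => (y t : ℂ))
  have hX : StronglyMeasurable X :=
    (rePart T).continuous.comp_stronglyMeasurable (h_meas.comp_measurable
      (measurable_pi_lambda _ fun t => Complex.measurable_ofReal.comp (measurable_pi_apply t)))
  have hZm t : Measurable fun ω => (z t ω).re := Complex.measurable_re.comp (hz t)
  have hXz : ∀ φ ∈ Θ, ∀ᵐ ω ∂(P φ), X (fun t => (z t ω).re) = rePart T (xhat fun t => z t ω) := by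
    intro φ hφ
    filter_upwards [hzre φ hφ] with ω hω
    simp only [X, hω]
  have hX2 : MemLp (fun ω => X (fun t => (z t ω).re)) 2 (P θ) := by
    refine ⟨(hX.comp_measurable (measurable_pi_lambda _ hZm)).aestronglyMeasurable, ?_⟩
    rw [eLpNorm_lt_top_iff_lintegral_rpow_enorm_lt_top (by norm_num) (by norm_num)]
    refine lt_of_le_of_lt (lintegral_mono_ae ?_) h_var
    filter_upwards [hXz θ hθ] with ω hω
    rw [hω]
    simpa using pow_le_pow_left' (enorm_rePart_le (xhat fun t => z t ω)) 2
  have hunb : ∀ φ ∈ Θ, ∀ f, ∫ ω, inner ℝ f (X (fun t => (z t ω).re)) ∂(P φ) =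
      inner ℝ f (rePart T (h φ)) := by
    intro φ hφ f
    obtain ⟨hi, he⟩ := h_unb φ hφ (Complex.ofRealCLM.compLpL 2 (window T) f)
    rw [inner_rePart, ← he, ← Complex.reCLM_apply, ← Complex.reCLM.integral_comp_comm hi]
    refine integral_congr_ae ?_
    filter_upwards [hXz φ hφ] with ω hω
    rw [hω, inner_rePart, Complex.reCLM_apply]
  refine (cramerRao_real hΘ hθ hdiff hinj hσ hZm hobs hX hX2 hunb).trans ?_
  refine lintegral_mono_ae ?_
  filter_upwards [hXz θ hθ] with ω hω
  rw [hω, ← map_sub]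
  exact pow_le_pow_left' (enorm_rePart_le _) 2

end ComplexSignals

/-! ### Rate of innovation and the final bound. -/

lemma localDegreesOfFreedom_le {K : ℕ} {T : ℝ} {X : Set (ℝ → ℂ)} {t : ℝ} {Θ : Set (Param K)}
    (hΘ : IsOpen Θ) {h : Param K → L2 T} (h_diff : ∀ θ ∈ Θ, DifferentiableAt ℝ h θ)
    (hX : segments T X t = h '' Θ) : localDegreesOfFreedom T X t ≤ K :=
  iInf₂_le K ⟨Θ, h, hΘ, h_diff, hX.symm⟩

lemma rateOfInnovation_le {K : ℕ} {T : ℝ} {X : Set (ℝ → ℂ)}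
    (hX : ∀ t, localDegreesOfFreedom T X t ≤ K) :
    rateOfInnovation T X ≤ (K : ℝ≥0∞) / ENNReal.ofReal T := by
  refine iSup_le fun t => ENNReal.div_le_div_right ?_ _
  exact_mod_cast ENat.toENNReal_mono (hX t)

end FRI

end

theorem theorem2 {K : ℕ} {T₀ σ : ℝ} (hT₀ : 0 < T₀) (hσ : 0 < σ)
    -- the signal model: `x = h θ` with `θ` in an open set `Θ ⊆ ℝᴷ`
    (Θ : Set (FRI.Param K)) (hΘ : IsOpen Θ)
    (h : FRI.Param K → FRI.L2 T₀)
    (h_real : ∀ θ ∈ Θ, ∀ᵐ t ∂(FRI.window T₀), (h θ t).im = 0)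
    -- `h` is Fréchet differentiable on `Θ`, with derivatives of trivial null space
    (dh : FRI.Param K → FRI.Param K →L[ℝ] FRI.L2 T₀)
    (h_diff : ∀ θ ∈ Θ, HasFDerivAt h (dh θ) θ)
    (h_null : ∀ θ ∈ Θ, ∀ v : FRI.Param K, dh θ v = 0 → v = 0)
    -- the measurements: under `P θ`, the signal `h θ` is observed in white Gaussian noise
    {Ω : Type*} [MeasurableSpace Ω] (P : FRI.Param K → Measure Ω)
    (z : Icc (0 : ℝ) T₀ → Ω → ℂ) (hz : ∀ t, Measurable (z t))
    (h_obs : ∀ θ ∈ Θ, FRI.IsNoisyObservation σ (h θ) z (P θ))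
    -- a measurable estimator, unbiased on the whole model
    (xhat : FRI.Estimator T₀) (h_meas : StronglyMeasurable xhat)
    (h_unb : FRI.IsUnbiased Θ h P z xhat)
    -- the actual parameter, where the estimator has finite variance
    (θ : FRI.Param K) (hθ : θ ∈ Θ)
    (h_var : ∫⁻ ω, ‖xhat fun t => z t ω‖ₑ ^ 2 ∂(P θ) < ∞) :
    ENNReal.ofReal (K * σ ^ 2) ≤ FRI.mse (P θ) z xhat (h θ) ∧
    -- if the model consists of the segments on `[0, T₀]` of signals on the real line, and this
    -- segment has the maximal number of degrees of freedom, the bound is the rate of innovation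
    ∀ X : Set (ℝ → ℂ),
      (∀ x ∈ X, ∀ a c : ℝ, MemLp x 2 (volume.restrict (Icc a c))) →
      FRI.segments T₀ X (T₀ / 2) = h '' Θ →
      (∀ t : ℝ, FRI.localDegreesOfFreedom T₀ X t ≤ FRI.localDegreesOfFreedom T₀ X (T₀ / 2)) →
      FRI.rateOfInnovation T₀ X ≤
        FRI.mse (P θ) z xhat (h θ) / ENNReal.ofReal T₀ / ENNReal.ofReal (σ ^ 2) := by
  have hmse := FRI.cramerRao hσ hΘ h_real hz h_obs h_meas h_unb hθ (h_diff θ hθ) (h_null θ hθ) h_var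
  refine ⟨hmse, fun X _ hseg hmax => ?_⟩
  -- Only an upper bound by K is needed: a more economical parametrization would just lower the
  -- rate.
  have hK : FRI.localDegreesOfFreedom T₀ X (T₀ / 2) ≤ K :=
    FRI.localDegreesOfFreedom_le hΘ (fun φ hφ => (h_diff φ hφ).differentiableAt) hseg
  refine (FRI.rateOfInnovation_le fun t => (hmax t).trans hK).trans ?_
  have hσ2 : ENNReal.ofReal (σ ^ 2) ≠ 0 := by simpa using hσ.ne'
  rw [ENNReal.le_div_iff_mul_le (.inl hσ2) (.inl ENNReal.ofReal_ne_top), ← ENNReal.mul_div_right_comm]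
  refine ENNReal.div_le_div_right ?_ _
  rwa [ENNReal.ofReal_mul (Nat.cast_nonneg K), ENNReal.ofReal_natCast] at hmse
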